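/- For a vertex $v$ of a graph $G$ let $G[v]$ be its neighbourhood. A ray is a one-way infinite path; a tail of a ray $R$ is an infinite connected subgraph of $R$; two rays are tail-equivalent if they share a common tail. Let $\mathcal G$ be the class of all graphs $G$ such that for every vertex $v$ the subgraph of $G$ induced on $G[v]$ contains at most one ray up to tail-equivalence. For a cardinal $\lambda$ let $\mathcal G_\lambda$ be the collection of isomorphism types of graphs in $\mathcal G$ with exactly $\lambda$ vertices, quasi-ordered by weak embeddability: $G_1\le_w G_2$ if $G_1$ is isomorphic to a (not necessarily induced) subgraph of $G_2$. For a set $A$ let $[A]^{\le\lambda}$ be the collection of all subsets of $A$ of cardinality at most $\lambda$. Theorem. Let $\lambda$ be a regular cardinal and let $\mu$ be an infinite cardinal with $\mu^+<\lambda$. Let $A$ be a set of cardinality $\mu^{\aleph_0}$. Then there is a surjective homomorphism $\Phi_\mu:\langle\mathcal G_\lambda,\le_w\rangle\to\langle[A]^{\le\lambda},\subseteq\rangle$, that is, a surjective map $\Phi_\mu:\mathcal G_\lambda\to[A]^{\le\lambda}$ such that $G_1\le_w G_2$ implies $\Phi_\mu(G_1)\subseteq\Phi_\mu(G_2)$.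 -/

import Mathlib

open Cardinal

universe u

namespace EndClass

section Rays

variable {V : Type u} {G : SimpleGraph V}

/-- A ray in `G`: a subgraph isomorphic to the one-way infinite path on `0, 1, 2, …`. -/
def IsRay (R : G.Subgraph) : Prop :=
  Nonempty (SimpleGraph.hasse ℕ ≃g R.coe)

/-- A tail of a ray `R`: an infinite connected subgraph of `R`. -/
def IsTail (T R : G.Subgraph) : Prop :=
  T ≤ R ∧ T.verts.Infinite ∧ T.Connected

/-- Two rays are tail-equivalent if they share a common tail. -/
def TailEquivalent (R S : G.Subgraph) : Prop :=
  ∃ T : G.Subgraph, IsTail T R ∧ IsTail T S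

/-- `G` belongs to the class `𝒢`: for every vertex `v`, the subgraph induced on the neighbourhood
of `v` has at most one ray up to tail-equivalence. -/
def InClass (G : SimpleGraph V) : Prop :=
  ∀ v : V, ∀ R S : (G.induce (G.neighborSet v)).Subgraph,
    IsRay R → IsRay S → TailEquivalent R S

end Rays

/-- A graph of the class `𝒢` with exactly `κ` vertices. -/
structure ClassGraph (κ : Cardinal.{u}) : Type (u + 1) where
  V : Type u
  graph : SimpleGraph V
  inClass : InClass graph
  card_eq : #V = κ

/-- Isomorphism of graphs. -/
instance ClassGraph.isoSetoid (κ : Cardinal.{u}) : Setoid (ClassGraph κ) where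
  r G H := Nonempty (G.graph ≃g H.graph)
  iseqv :=
    { refl := fun _ => ⟨SimpleGraph.Iso.refl⟩
      symm := fun ⟨e⟩ => ⟨e.symm⟩
      trans := fun ⟨e⟩ ⟨f⟩ => ⟨f.comp e⟩ }

/-- `𝒢_κ`: the isomorphism types of graphs of cardinality `κ` in the class `𝒢`. -/
def IsoType (κ : Cardinal.{u}) : Type (u + 1) :=
  Quotient (ClassGraph.isoSetoid κ)

/-- The quasi-order `≤_w` of weak embeddability on isomorphism types:
`G ≤_w H` if `G` is isomorphic to a (not necessarily induced) subgraph of `H`. -/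
instance IsoType.weakEmbeddability (κ : Cardinal.{u}) : Preorder (IsoType κ) where
  le := Quotient.lift₂ (fun G H : ClassGraph κ => G.graph.IsContained H.graph) (by
    rintro G₁ H₁ G₂ H₂ ⟨e⟩ ⟨f⟩
    exact propext ⟨fun h => (SimpleGraph.IsContained.trans ⟨e.symm.toCopy⟩ h).trans ⟨f.toCopy⟩,
      fun h => (SimpleGraph.IsContained.trans ⟨e.toCopy⟩ h).trans ⟨f.symm.toCopy⟩⟩)
  le_refl := by
    rintro ⟨G⟩
    exact SimpleGraph.IsContained.refl G.graph
  le_trans := by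
    rintro ⟨G⟩ ⟨H⟩ ⟨K⟩ h₁ h₂
    exact SimpleGraph.IsContained.trans h₁ h₂

end EndClass

/-! Identify the vertices of a graph with `κ`. A weak embedding respects the cuts `e x < α` for all
`α` in some club, so information coded by cuts at club points passes to larger graphs and does not
depend on the enumeration. As `μ⁺ < κ`, club guessing (`exists_guess`) gives each `δ` of cofinality
`μ⁺` an increasing sequence `c δ` below `δ` such that every closure set contains some `δ` together
with all of `c δ`. The index order is `ℕ ×ₗ μ`, which carries `μ ^ ℵ₀` increasing, pairwise almost
disjoint `ω`-sequences `pos a`, one for each `a ∈ A`.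

The image of `G` is the set of `a` such that, at all guesses in some closure set, a vertex has a ray
in its neighbourhood whose cuts in `c δ` follow `pos a`. In the class, two rays at one vertex meet
infinitely often, so `δ` and the vertex determine `a`; this bounds the image (`mk_spectrum_le`).
Monotonicity is `spectrum_mono`.

To realise `B`, take the tree of finite sequences in `κ` and put an apex over each branch `c δ ∘ pos
a` with `a ∈ B`. Joining the apex also to a ladder of `δ` makes `δ` recoverable, so no other code
appears (`spectrum_codeGraph_subset`). -/

namespace EndClass

/-! ### Regular well-orders and transfinite recursion -/

/-- A well-ordered type behaving like the initial ordinal of the regular cardinal `θ`. -/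
structure IsRegularType (X : Type u) [LinearOrder X] (θ : Cardinal.{u}) : Prop where
  card_eq : #X = θ
  card_Iio_lt : ∀ x : X, #(Set.Iio x) < θ
  exists_gt : ∀ {ι : Type u} (g : ι → X), #ι < θ → ∃ b, ∀ i, g i < b

theorem isRegularType_ord_toType {θ : Cardinal.{u}} (hθ : θ.IsRegular) :
    IsRegularType θ.ord.ToType θ where
  card_eq := mk_ord_toType θ
  card_Iio_lt i := (mk_Iio_lt i (by simp)).trans_eq (mk_ord_toType θ)
  exists_gt {ι} g hι := by
    have : NoMaxOrder θ.ord.ToType := noMaxOrder hθ.aleph0_le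
    have hcof : Order.cof θ.ord.ToType = θ := by rw [Ordinal.cof_toType, hθ.cof_ord]
    have hnc : ¬ IsCofinal (Set.range g) := fun h =>
      absurd (Order.cof_le h) (not_le.2 (mk_range_le.trans_lt (hι.trans_eq hcof.symm)))
    simp only [IsCofinal, not_forall] at hnc
    obtain ⟨b, hb⟩ := hnc
    exact ⟨b, fun i => lt_of_not_ge fun h => hb ⟨g i, ⟨i, rfl⟩, h⟩⟩

/-- Well-founded recursion producing a strictly increasing transfinite sequence. -/
theorem exists_strictMono_comp {W Z T : Type u} [LinearOrder W] [WellFoundedLT W] [Preorder T]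
    (Y : Z → T) (good : Z → Prop)
    (h : ∀ (w : W) (g : Set.Iio w → Z), ∃ z, good z ∧ ∀ i, Y (g i) < Y z) :
    ∃ q : W → Z, StrictMono (Y ∘ q) ∧ ∀ w, good (q w) := by
  choose F hF using h
  let q : W → Z := (wellFounded_lt (α := W)).fix
    (C := fun _ => Z) fun w g => F w fun i => g i.1 i.2
  have hq : ∀ w, q w = F w fun i => q i.1 := fun w => WellFounded.fix_eq _ _ w
  refine ⟨q, fun a b hab => ?_, fun w => ?_⟩
  · have := (hF b fun i => q i.1).2 ⟨a, hab⟩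
    simpa [hq b] using this
  · rw [hq]
    exact (hF w _).1

theorem IsRegularType.exists_gt_of_lt {X : Type u} [LinearOrder X] {θ : Cardinal.{u}}
    (hX : IsRegularType X θ) (hθ : ℵ₀ ≤ θ) (a : X) : ∃ b, a < b := by
  obtain ⟨b, hb⟩ := hX.exists_gt (fun _ : PUnit => a) (by simpa using one_lt_aleph0.trans_le hθ)
  exact ⟨b, hb ⟨⟩⟩

/-- A set bounded by a small initial segment has a common strict bound. -/
theorem IsRegularType.exists_gt_image {X : Type u} [LinearOrder X] {θ : Cardinal.{u}}
    (hX : IsRegularType X θ) (φ : X → X) (x : X) : ∃ b, ∀ a < x, φ a < b := by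
  obtain ⟨b, hb⟩ := hX.exists_gt (fun i : Set.Iio x => φ i) (hX.card_Iio_lt x)
  exact ⟨b, fun a ha => hb ⟨a, ha⟩⟩

/-! ### Closure sets and their largest points below a bound -/

section Closure

variable {I : Type u} [LinearOrder I]

/-- The closed set of points closed under `φ`. -/
def closurePoints (φ : I → I) : Set I := {α | ∀ β < α, φ β ≤ α}

theorem closurePoints_anti {φ ψ : I → I} (h : ∀ β, φ β ≤ ψ β) :
    closurePoints ψ ⊆ closurePoints φ := fun _ hα β hβ => (h β).trans (hα β hβ)

theorem mem_closurePoints_of_isLUB {φ : I → I} {s : Set I} (hs : s ⊆ closurePoints φ) {a : I}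
    (ha : IsLUB s a) : a ∈ closurePoints φ := by
  intro β hβ
  obtain ⟨γ, hγ, hβγ, hγa⟩ := ha.exists_between hβ
  exact (hs hγ β hβγ).trans hγa

variable [WellFoundedLT I]

theorem exists_isLUB_of_bdd {s : Set I} (hs : ∃ b, ∀ a ∈ s, a ≤ b) : ∃ a, IsLUB s a := by
  obtain ⟨m, hm, hmin⟩ := (wellFounded_lt (α := I)).has_min (upperBounds s) hs
  exact ⟨m, hm, fun b hb => not_lt.1 (hmin b hb)⟩

/-- The least element is vacuously a closure point, so even an empty supremum is one. -/
theorem exists_isGreatest_closurePoints (φ : I → I) (a : I) :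
    ∃ s, IsGreatest (closurePoints φ ∩ Set.Iic a) s := by
  obtain ⟨s, hs⟩ := exists_isLUB_of_bdd (s := closurePoints φ ∩ Set.Iic a) ⟨a, fun _ h => h.2⟩
  exact ⟨s, ⟨mem_closurePoints_of_isLUB Set.inter_subset_left hs, hs.2 fun _ h => h.2⟩, hs.1⟩

/-- The largest closure point of `φ` below `a`. -/
noncomputable def drop (φ : I → I) (a : I) : I := (exists_isGreatest_closurePoints φ a).choose

theorem drop_isGreatest (φ : I → I) (a : I) :
    IsGreatest (closurePoints φ ∩ Set.Iic a) (drop φ a) :=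
  (exists_isGreatest_closurePoints φ a).choose_spec

theorem drop_mem (φ : I → I) (a : I) : drop φ a ∈ closurePoints φ := (drop_isGreatest φ a).1.1

theorem drop_le (φ : I → I) (a : I) : drop φ a ≤ a := (drop_isGreatest φ a).1.2

theorem le_drop {φ : I → I} {a b : I} (hb : b ∈ closurePoints φ) (hba : b ≤ a) : b ≤ drop φ a :=
  (drop_isGreatest φ a).2 ⟨hb, hba⟩

theorem drop_anti {φ ψ : I → I} (h : ∀ β, φ β ≤ ψ β) (a : I) : drop ψ a ≤ drop φ a :=
  le_drop (closurePoints_anti h (drop_mem ψ a)) (drop_le ψ a)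

theorem drop_mono (φ : I → I) {a b : I} (h : a ≤ b) : drop φ a ≤ drop φ b :=
  le_drop (drop_mem φ a) ((drop_le φ a).trans h)

/-- The supremum of `ω` steps, each going beyond all earlier values of `φ`; it exists because `κ` is
regular and uncountable. -/
theorem exists_closurePoint_gt {κ : Cardinal.{u}} (hI : IsRegularType I κ) (hκ : ℵ₀ < κ)
    (φ : I → I) (a : I) : ∃ α ∈ closurePoints φ, a < α := by
  have step : ∀ x : I, ∃ y, x < y ∧ ∀ β < x, φ β < y := fun x => by
    obtain ⟨b, hb⟩ := hI.exists_gt_image φ x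
    obtain ⟨c, hc⟩ := hI.exists_gt_of_lt hκ.le (max x b)
    exact ⟨c, (le_max_left _ _).trans_lt hc,
      fun β hβ => (hb β hβ).trans ((le_max_right _ _).trans_lt hc)⟩
  choose S hS hS' using step
  let g : ℕ → I := fun n => S^[n] a
  have hg : ∀ n, g (n + 1) = S (g n) := fun n => Function.iterate_succ_apply' S n a
  obtain ⟨b, hb⟩ := hI.exists_gt (fun n : ULift.{u} ℕ => g n.down) (by simpa using hκ)
  obtain ⟨s, hs⟩ := exists_isLUB_of_bdd (s := Set.range g)
    ⟨b, by rintro _ ⟨n, rfl⟩; exact (hb ⟨n⟩).le⟩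
  refine ⟨s, fun β hβ => ?_, ?_⟩
  · obtain ⟨_, ⟨n, rfl⟩, hn, -⟩ := hs.exists_between hβ
    exact ((hS' _ β hn).trans_eq (hg n).symm).le.trans (hs.1 ⟨n + 1, rfl⟩)
  · exact (hS a).trans_le (hs.1 ⟨1, rfl⟩)

end Closure

/-! ### Club guessing at points of cofinality `μ⁺` -/

section Guessing

variable {I N P : Type u} [LinearOrder I] [LinearOrder N] [LinearOrder P]

/-- An increasing transfinite sequence cofinal in `δ`. -/
structure IsLadder (δ : I) (f : N → I) : Prop where
  strictMono : StrictMono f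
  lt : ∀ i, f i < δ
  exists_ge : ∀ α < δ, ∃ i, α ≤ f i

variable (N) in
/-- The points of `I` approached by an increasing `N`-sequence. -/
def LadderPoint (I : Type u) [LinearOrder I] : Type u := {δ : I // ∃ f : N → I, IsLadder δ f}

/-- A chosen ladder at `δ`. -/
noncomputable def LadderPoint.ladder (δ : LadderPoint N I) : N → I := δ.2.choose

theorem LadderPoint.isLadder (δ : LadderPoint N I) : IsLadder δ.1 δ.ladder := δ.2.choose_spec

variable [WellFoundedLT I] [WellFoundedLT N] [WellFoundedLT P]

theorem exists_ladderPoint {κ μ : Cardinal.{u}} (hI : IsRegularType I κ)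
    (hN : IsRegularType N (Order.succ μ)) (hμ : ℵ₀ ≤ μ) (hμκ : Order.succ μ < κ) (φ : I → I) :
    ∃ δ : LadderPoint N I, ∀ α < δ.1, ∃ β ∈ closurePoints φ, α < β ∧ β < δ.1 := by
  have hκ : ℵ₀ < κ := hμ.trans_lt ((Order.lt_succ μ).trans hμκ)
  obtain ⟨t, ht, htC⟩ := exists_strictMono_comp (W := N) (fun x : I => x)
    (· ∈ closurePoints φ) fun w g => by
      obtain ⟨b, hb⟩ := hI.exists_gt g ((hN.card_Iio_lt w).trans hμκ)
      obtain ⟨α, hα, hbα⟩ := exists_closurePoint_gt hI hκ φ b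
      exact ⟨α, hα, fun i => (hb i).trans hbα⟩
  obtain ⟨b, hb⟩ := hI.exists_gt t (hN.card_eq.trans_lt hμκ)
  obtain ⟨δ, hδ⟩ := exists_isLUB_of_bdd (s := Set.range t)
    ⟨b, by rintro _ ⟨n, rfl⟩; exact (hb n).le⟩
  have hlt : ∀ i, t i < δ := fun i => by
    obtain ⟨j, hj⟩ := hN.exists_gt_of_lt (hμ.trans (Order.le_succ μ)) i
    exact (ht hj).trans_le (hδ.1 ⟨j, rfl⟩)
  refine ⟨⟨δ, t, ht, hlt, fun α hα => ?_⟩, fun α hα => ?_⟩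
  · obtain ⟨_, ⟨i, rfl⟩, hi, -⟩ := hδ.exists_between hα
    exact ⟨i, hi.le⟩
  · obtain ⟨_, ⟨i, rfl⟩, hi, -⟩ := hδ.exists_between hα
    exact ⟨t i, htC i, hi, hlt i⟩

omit [WellFoundedLT I] [WellFoundedLT N] in
/-- An unbounded monotone sequence along a regular type has a strictly increasing
`P`-subsequence taken from a proper initial segment. -/
theorem exists_strictMono_subsequence {μ : Cardinal.{u}} (hN : IsRegularType N (Order.succ μ))
    (hP : #P ≤ μ) {Y : N → I} (hY : Monotone Y) (hY' : ∀ i, ∃ j, Y i < Y j) :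
    ∃ (j : N) (q : P → N), StrictMono (Y ∘ q) ∧ ∀ p, q p < j := by
  obtain ⟨q, hq, -⟩ := exists_strictMono_comp (W := P) Y (fun _ => True) fun w g => by
    obtain ⟨b, hb⟩ := hN.exists_gt g (Order.lt_succ_of_le ((mk_set_le _).trans hP))
    obtain ⟨c, hc⟩ := hY' b
    exact ⟨c, trivial, fun i => (hY (hb i).le).trans_lt hc⟩
  obtain ⟨j, hj⟩ := hN.exists_gt q (Order.lt_succ_of_le hP)
  exact ⟨j, q, hq, hj⟩

/-- One closure function and one initial segment of the ladders suffice for guessing. -/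
theorem exists_uniform_guess {κ μ : Cardinal.{u}} (hI : IsRegularType I κ)
    (hN : IsRegularType N (Order.succ μ)) (hμ : ℵ₀ ≤ μ) (hμκ : Order.succ μ < κ) (hP : #P ≤ μ) :
    ∃ (φ : I → I) (j : N), ∀ ψ : I → I, ∃ δ : LadderPoint N I, δ.1 ∈ closurePoints ψ ∧
      (∃ q : P → N, StrictMono (drop φ ∘ δ.ladder ∘ q) ∧ ∀ p, q p < j) ∧
      ∀ i < j, drop φ (δ.ladder i) ∈ closurePoints ψ := by
  -- Each pair `φ`, `j` now has a counterexample `Ψ φ j`. Iterating `μ⁺` times and absorbing all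
  -- counterexamples to earlier stages yields a limit `lim` that is guessed after all by one of the
  -- stages.
  by_contra hcon
  push Not at hcon
  choose Ψ hΨ using hcon
  have hsup : ∀ {ι : Type u} (g : ι → I → I), #ι < κ → ∃ ψ : I → I, ∀ i β, g i β ≤ ψ β := by
    intro ι g hι
    choose ψ hψ using fun β => hI.exists_gt (fun i => g i β) hι
    exact ⟨ψ, fun i β => (hψ β i).le⟩
  have hstep : ∀ φ : I → I, ∃ ψ : I → I, (∀ β, φ β ≤ ψ β) ∧ ∀ j β, Ψ φ j β ≤ ψ β := by
    intro φ
    obtain ⟨ψ, hψ⟩ := hsup (Ψ φ) (hN.card_eq.trans_lt hμκ)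
    exact ⟨fun β => max (φ β) (ψ β), fun β => le_max_left _ _,
      fun j β => (hψ j β).trans (le_max_right _ _)⟩
  choose next hnext hnextΨ using hstep
  have hlim : ∀ (w : N) (g : Set.Iio w → I → I), ∃ ψ : I → I, ∀ i β, next (g i) β ≤ ψ β :=
    fun w g => hsup (fun i => next (g i)) ((hN.card_Iio_lt w).trans hμκ)
  choose F hF using hlim
  let stage : N → I → I := (wellFounded_lt (α := N)).fix
    (C := fun _ => I → I) fun w g => F w fun i => g i.1 i.2
  have hstage : ∀ w, stage w = F w fun i => stage i.1 := fun w => WellFounded.fix_eq _ _ w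
  have hstage_lt : ∀ {i k : N}, i < k → ∀ β, next (stage i) β ≤ stage k β := by
    intro i k hik β
    rw [hstage k]
    exact hF k (fun i => stage i.1) ⟨i, hik⟩ β
  have hstage_mono : ∀ {i k : N}, i ≤ k → ∀ β, stage i β ≤ stage k β := by
    intro i k hik β
    rcases hik.eq_or_lt with rfl | h
    · rfl
    · exact (hnext _ β).trans (hstage_lt h β)
  -- `lim` is the pointwise least upper bound of the stages
  have hLUB : ∀ β, ∃ s, IsLUB (Set.range fun i => stage i β) s := fun β => by
    obtain ⟨b, hb⟩ := hI.exists_gt (fun i => stage i β) (hN.card_eq.trans_lt hμκ)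
    exact exists_isLUB_of_bdd ⟨b, by rintro _ ⟨i, rfl⟩; exact (hb i).le⟩
  choose lim hlim using hLUB
  have hle_lim : ∀ i β, stage i β ≤ lim β := fun i β => (hlim β).1 ⟨i, rfl⟩
  -- Drops decrease as the stage grows, so they become constant; the final value is closed under
  -- every stage, hence under `lim`.
  have hstab : ∀ a, ∃ i₀, ∀ i ≥ i₀, drop (stage i) a = drop lim a := by
    intro a
    have hN0 : Nonempty N := by
      obtain ⟨b, -⟩ := hN.exists_gt (fun x : PEmpty.{u+1} => x.elim) (by
        simp)
      exact ⟨b⟩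
    obtain ⟨s, ⟨i₀, rfl⟩, hmin⟩ := (wellFounded_lt (α := I)).has_min
      (Set.range fun i => drop (stage i) a) (Set.range_nonempty _)
    have hconst : ∀ i ≥ i₀, drop (stage i) a = drop (stage i₀) a := fun i hi =>
      le_antisymm (drop_anti (hstage_mono hi) a) (not_lt.1 (hmin _ ⟨i, rfl⟩))
    refine ⟨i₀, fun i hi => (hconst i hi).trans (le_antisymm ?_ (drop_anti (hle_lim i₀) a))⟩
    refine le_drop (fun β hβ => (hlim β).2 ?_) (drop_le _ _)
    rintro _ ⟨k, rfl⟩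
    have := drop_mem (stage (max k i₀)) a
    rw [hconst _ (le_max_right _ _)] at this
    exact (hstage_mono (le_max_left k i₀) β).trans (this β hβ)
  obtain ⟨δ, hδ⟩ := exists_ladderPoint hI hN hμ hμκ lim
  have hδmem : δ.1 ∈ closurePoints lim := fun β hβ => by
    obtain ⟨γ, hγ, hβγ, hγδ⟩ := hδ β hβ
    exact (hγ β hβγ).trans hγδ.le
  obtain ⟨j, q, hq, hqj⟩ := exists_strictMono_subsequence (P := P) (Y := drop lim ∘ δ.ladder) hN hP
    (fun a b hab => drop_mono lim (δ.isLadder.strictMono.monotone hab)) fun i => by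
      obtain ⟨β, hβ, hiβ, hβδ⟩ := hδ (δ.ladder i) (δ.isLadder.lt i)
      obtain ⟨k, hk⟩ := δ.isLadder.exists_ge β hβδ
      exact ⟨k, (drop_le _ _).trans_lt (hiβ.trans_le (le_drop hβ hk))⟩
  choose st hst using hstab
  -- At most `μ` indices lie below `j`, so one stage `i` is past all their stabilisation points.
  obtain ⟨i, hi⟩ := hN.exists_gt (fun k : Set.Iio j => st (δ.ladder k)) (hN.card_Iio_lt j)
  have hdrop : ∀ k < j, drop (stage i) (δ.ladder k) = drop lim (δ.ladder k) :=
    fun k hk => hst _ i (hi ⟨k, hk⟩).le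
  have hΨlim : ∀ β, Ψ (stage i) j β ≤ lim β := fun β => by
    obtain ⟨k, hk⟩ := hN.exists_gt_of_lt (hμ.trans (Order.le_succ μ)) i
    exact (hnextΨ _ j β).trans ((hstage_lt hk β).trans (hle_lim k β))
  have hsub := closurePoints_anti hΨlim
  have hq' : StrictMono (drop (stage i) ∘ δ.ladder ∘ q) := by
    convert hq using 1
    funext p
    exact hdrop _ (hqj p)
  obtain ⟨k, hk, hkn⟩ := hΨ (stage i) j δ (hsub hδmem) ⟨q, hq', hqj⟩
  exact hkn (hdrop k hk ▸ hsub (drop_mem lim _))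

/-- Club guessing: every closure set is guessed at some ladder point by a `P`-sequence. -/
theorem exists_guess {κ μ : Cardinal.{u}} (hI : IsRegularType I κ)
    (hN : IsRegularType N (Order.succ μ)) (hμ : ℵ₀ ≤ μ) (hμκ : Order.succ μ < κ) (hP : #P ≤ μ) :
    ∃ c : LadderPoint N I → P → I, (∀ δ, StrictMono (c δ)) ∧ (∀ δ p, c δ p < δ.1) ∧
      ∀ ψ : I → I, ∃ δ : LadderPoint N I, δ.1 ∈ closurePoints ψ ∧
        ∀ p, c δ p ∈ closurePoints ψ := by
  obtain ⟨φ, j, h⟩ := exists_uniform_guess (P := P) hI hN hμ hμκ hP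
  have hc : ∀ δ : LadderPoint N I, ∃ g : P → I, StrictMono g ∧ (∀ p, g p < δ.1) ∧
      ((∃ q : P → N, StrictMono (drop φ ∘ δ.ladder ∘ q) ∧ ∀ p, q p < j) →
        ∀ p, ∃ i < j, g p = drop φ (δ.ladder i)) := by
    intro δ
    by_cases hq : ∃ q : P → N, StrictMono (drop φ ∘ δ.ladder ∘ q) ∧ ∀ p, q p < j
    · obtain ⟨q, hq, hqj⟩ := hq
      exact ⟨_, hq, fun p => (drop_le _ _).trans_lt (δ.isLadder.lt _), fun _ p => ⟨q p, hqj p, rfl⟩⟩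
    -- A default value at points where the dropped ladder has no suitable subsequence; only
    -- monotonicity is needed there.
    · obtain ⟨k, q, hq', -⟩ := exists_strictMono_subsequence (P := P) hN hP
        δ.isLadder.strictMono.monotone fun i => by
          obtain ⟨k, hk⟩ := hN.exists_gt_of_lt (hμ.trans (Order.le_succ μ)) i
          exact ⟨k, δ.isLadder.strictMono hk⟩
      exact ⟨_, hq', fun p => δ.isLadder.lt _, fun h => absurd h hq⟩
  choose c hc₁ hc₂ hc₃ using hc
  refine ⟨c, hc₁, hc₂, fun ψ => ?_⟩
  obtain ⟨δ, hδ, hq, hδj⟩ := h ψ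
  refine ⟨δ, hδ, fun p => ?_⟩
  obtain ⟨i, hi, hp⟩ := hc₃ δ hq p
  exact hp ▸ hδj i hi

end Guessing

end EndClass

namespace EndClass

/-- A relation with fewer than `κ` successors at each point stays below `α` for closure points `α`.
The bound `η`, strictly below `α`, is what later transfers cofinality. -/
theorem exists_closurePoints_relation {I : Type u} [LinearOrder I] {κ : Cardinal.{u}}
    (hI : IsRegularType I κ) (hκ : ℵ₀ ≤ κ) {S : I → Type u} (r : ∀ β, S β → I)
    (hr : ∀ β, #(S β) < κ) :
    ∃ φ : I → I, ∀ α ∈ closurePoints φ, ∀ β < α, ∃ η < α, ∀ γ, r β γ < η := by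
  choose φ hφ using fun β => hI.exists_gt (r β) (hr β)
  choose ψ hψ using fun β => hI.exists_gt_of_lt hκ (φ β)
  exact ⟨ψ, fun α hα β hβ => ⟨φ β, (hψ β).trans_le (hα β hβ), hφ β⟩⟩

theorem IsRegularType.card_Iic_lt {I : Type u} [LinearOrder I] {κ : Cardinal.{u}}
    (hI : IsRegularType I κ) (hκ : ℵ₀ ≤ κ) (β : I) : #(Set.Iic β) < κ := by
  obtain ⟨b, hb⟩ := hI.exists_gt_of_lt hκ β
  exact (mk_le_mk_of_subset fun x (hx : x ≤ β) => hx.trans_lt hb).trans_lt (hI.card_Iio_lt b)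

theorem exists_closurePoints_inter {I : Type u} [LinearOrder I] (φ ψ : I → I) :
    ∃ χ : I → I, closurePoints χ ⊆ closurePoints φ ∩ closurePoints ψ :=
  ⟨fun β => max (φ β) (ψ β), fun _ h => ⟨closurePoints_anti (fun _ => le_max_left _ _) h,
    closurePoints_anti (fun _ => le_max_right _ _) h⟩⟩

/-! ### Rays in neighbourhoods as sequences -/

section Rays

variable {V W : Type u} {G : SimpleGraph V} {H : SimpleGraph W}

/-- `x` enumerates a ray in the neighbourhood of `v`. -/
structure IsRaySeq (G : SimpleGraph V) (v : V) (x : ℕ → V) : Prop where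
  injective : Function.Injective x
  adj : ∀ n, G.Adj v (x n)
  adj_succ : ∀ n, G.Adj (x n) (x (n + 1))

theorem IsRaySeq.map {v : V} {x : ℕ → V} (hx : IsRaySeq G v x) (f : SimpleGraph.Copy G H) :
    IsRaySeq H (f v) (f ∘ x) where
  injective := f.injective.comp hx.injective
  adj n := f.toHom.map_adj (hx.adj n)
  adj_succ n := f.toHom.map_adj (hx.adj_succ n)

theorem IsRaySeq.shift {v : V} {x : ℕ → V} (hx : IsRaySeq G v x) (m : ℕ) :
    IsRaySeq G v fun n => x (n + m) where
  injective a b h := Nat.add_right_cancel (hx.injective h)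
  adj n := hx.adj _
  adj_succ n := by
    have := hx.adj_succ (n + m)
    rwa [Nat.add_right_comm] at this

/-- A ray enumeration as a copy of the one-way infinite path. -/
def IsRaySeq.copy {v : V} {x : ℕ → V} (hx : IsRaySeq G v x) :
    SimpleGraph.Copy (SimpleGraph.hasse ℕ) (G.induce (G.neighborSet v)) where
  toHom :=
    { toFun := fun n => ⟨x n, hx.adj n⟩
      map_rel' := by
        intro a b h
        rw [SimpleGraph.hasse_adj, Nat.covBy_iff_add_one_eq, Nat.covBy_iff_add_one_eq] at h
        rcases h with rfl | rfl
        · exact hx.adj_succ a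
        · exact (hx.adj_succ b).symm }
  injective' a b h := hx.injective (congrArg Subtype.val h)

theorem IsRaySeq.isRay {v : V} {x : ℕ → V} (hx : IsRaySeq G v x) : IsRay hx.copy.toSubgraph :=
  ⟨hx.copy.isoToSubgraph⟩

/-- Every ray in a neighbourhood is enumerated by a sequence. -/
theorem IsRay.exists_seq {v : V} {R : (G.induce (G.neighborSet v)).Subgraph} (hR : IsRay R) :
    ∃ x : ℕ → V, ∃ hx : IsRaySeq G v x, hx.copy.toSubgraph ≤ R := by
  obtain ⟨e⟩ := hR
  have hadj : ∀ n, R.Adj (e n).1 (e (n + 1)).1 := fun n => by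
    have : R.coe.Adj (e n) (e (n + 1)) := e.map_adj_iff.2 (by
      rw [SimpleGraph.hasse_adj, Nat.covBy_iff_add_one_eq]
      exact Or.inl rfl)
    exact this
  have hx : IsRaySeq G v fun n => ((e n).1 : V) :=
    { injective := fun a b h => e.injective (Subtype.ext (Subtype.ext h))
      adj := fun n => (e n).1.2
      adj_succ := fun n => (hadj n).adj_sub }
  refine ⟨_, hx, ?_, ?_⟩
  · rintro _ ⟨n, -, rfl⟩
    exact (e n).2
  · rintro _ _ ⟨a, b, h, rfl, rfl⟩
    have h' : (SimpleGraph.hasse ℕ).Adj a b := h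
    rw [SimpleGraph.hasse_adj, Nat.covBy_iff_add_one_eq, Nat.covBy_iff_add_one_eq] at h'
    rcases h' with rfl | rfl
    · exact hadj a
    · exact (hadj b).symm

/-- Two rays in one neighbourhood of a graph of the class share infinitely many vertices. -/
theorem IsRaySeq.infinite_common (hG : InClass G) {v : V} {x y : ℕ → V} (hx : IsRaySeq G v x)
    (hy : IsRaySeq G v y) : {n | ∃ m, x n = y m}.Infinite := by
  obtain ⟨T, ⟨hTx, hT, -⟩, hTy, -⟩ := hG v _ _ hx.isRay hy.isRay
  intro hfin
  refine hT ((hfin.image fun n => hx.copy n).subset fun t ht => ?_)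
  obtain ⟨n, -, rfl⟩ := hTx.1 ht
  obtain ⟨m, -, hm⟩ := hTy.1 ht
  exact ⟨n, ⟨m, congrArg Subtype.val hm.symm⟩, rfl⟩

end Rays

/-! ### The spectrum as a monotone invariant -/

section Spectrum

variable {I P : Type u} [LinearOrder I] [LinearOrder P] {C : Type u}
variable {V W : Type u} {G : SimpleGraph V} {H : SimpleGraph W}

/-- The vertex `v` sees a ray following the positions `pos` of `c`, and has neighbours cofinal
below `δ`. -/
def Located (G : SimpleGraph V) (e : V ≃ I) (δ : I) (c : P → I) (pos : ℕ → P) (v : V) : Prop :=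
  (∃ (x : ℕ → V) (m : ℕ), IsRaySeq G v x ∧ ∀ n p, c p ≤ e (x n) ↔ p ≤ pos (n + m)) ∧
    -- The sequence `c` need not be cofinal in `δ`; this clause ties `v` to `δ`.
    ∀ α < δ, ∃ y, G.Adj v y ∧ α ≤ e y ∧ e y < δ

/-- A vertex common to both rays makes the same cut in `c`, so infinitely many common vertices give
infinitely many common positions. -/
theorem Located.eq (hG : InClass G) {e : V ≃ I} {δ : I} {c : P → I} {pos : C → ℕ → P}
    (hpos : ∀ a b, {n | ∃ m, pos a n = pos b m}.Infinite → a = b) {v : V} {a b : C}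
    (ha : Located G e δ c (pos a) v) (hb : Located G e δ c (pos b) v) : a = b := by
  obtain ⟨⟨x, m, hx, hxc⟩, -⟩ := ha
  obtain ⟨⟨y, k, hy, hyc⟩, -⟩ := hb
  refine hpos a b ?_
  have hinf := (hx.infinite_common hG hy).image (f := fun n => n + m)
    fun _ _ _ _ h => Nat.add_right_cancel h
  refine hinf.mono ?_
  rintro _ ⟨n, ⟨l, hl⟩, rfl⟩
  exact ⟨l + k, eq_of_forall_le_iff fun p => by rw [← hxc n p, hl, hyc]⟩

/-- The codes located at every guess lying in a suitable closure set. -/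
def spectrum {Δ : Type u} (d : Δ → I) (c : Δ → P → I) (pos : C → ℕ → P) (G : SimpleGraph V)
    (e : V ≃ I) : Set C :=
  {a | ∃ φ : I → I, ∀ δ, d δ ∈ closurePoints φ → (∀ p, c δ p ∈ closurePoints φ) →
    ∃ v, Located G e (d δ) (c δ) (pos a) v}

variable {Δ : Type u} {d : Δ → I} {c : Δ → P → I} {pos : C → ℕ → P}

theorem mk_spectrum_le {κ : Cardinal.{u}} (hκ : ℵ₀ ≤ κ) (hΔ : #Δ ≤ κ) (hV : #V ≤ κ)
    (hG : InClass G) (e : V ≃ I)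
    (hpos : ∀ a b, {n | ∃ m, pos a n = pos b m}.Infinite → a = b)
    (hguess : ∀ φ : I → I, ∃ δ, d δ ∈ closurePoints φ ∧ ∀ p, c δ p ∈ closurePoints φ) :
    #(spectrum d c pos G e) ≤ κ := by
  have h : ∀ a : spectrum d c pos G e, ∃ δv : Δ × V,
      Located G e (d δv.1) (c δv.1) (pos a) δv.2 := by
    rintro ⟨a, φ, hφ⟩
    obtain ⟨δ, hδ, hδ'⟩ := hguess φ
    obtain ⟨v, hv⟩ := hφ δ hδ hδ'
    exact ⟨(δ, v), hv⟩
  choose f hf using h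
  have hinj : Function.Injective f := fun a b hab =>
    Subtype.ext (Located.eq hG hpos (hf a) (hab ▸ hf b))
  calc #(spectrum d c pos G e) ≤ #(Δ × V) := mk_le_of_injective hinj
    _ = #Δ * #V := by rw [mk_prod, lift_id, lift_id]
    _ ≤ κ * κ := mul_le_mul' hΔ hV
    _ = κ := mul_eq_self hκ

/-- By injectivity, closure points `α` satisfy `e' (f x) < α ↔ e x < α`, so `f v` inherits the
location of `v`. -/
theorem spectrum_mono {κ : Cardinal.{u}} (hI : IsRegularType I κ) (hκ : ℵ₀ ≤ κ) {e : V ≃ I}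
    {e' : W ≃ I} (f : SimpleGraph.Copy G H) :
    spectrum d c pos G e ⊆ spectrum d c pos H e' := by
  obtain ⟨g₁, hg₁⟩ := exists_closurePoints_relation hI hκ
    (S := fun _ => PUnit) (fun β _ => e' (f (e.symm β)))
    fun β => by simpa using one_lt_aleph0.trans_le hκ
  obtain ⟨g₂, hg₂⟩ := exists_closurePoints_relation hI hκ
    (S := fun β => {γ : I // e' (f (e.symm γ)) ≤ β}) (fun β γ => γ.1) fun β =>
      (mk_le_of_injective (f := fun γ => (⟨e' (f (e.symm γ.1)), γ.2⟩ : Set.Iic β))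
        fun a b h => Subtype.ext (e.symm.injective (f.injective (e'.injective
          (congrArg Subtype.val h))))).trans_lt (hI.card_Iic_lt hκ β)
  have key : ∀ α ∈ closurePoints g₁, α ∈ closurePoints g₂ → ∀ x, e' (f x) < α ↔ e x < α := by
    refine fun α h₁ h₂ x => ⟨fun h => ?_, fun h => ?_⟩
    · obtain ⟨η, hη, H⟩ := hg₂ α h₂ _ h
      exact (H ⟨e x, by simp⟩).trans hη
    · obtain ⟨η, hη, H⟩ := hg₁ α h₁ _ h
      simpa using (H ⟨⟩).trans hη
  rintro a ⟨φ, hφ⟩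
  obtain ⟨χ, hχ⟩ := exists_closurePoints_inter g₁ g₂
  obtain ⟨ψ, hψ⟩ := exists_closurePoints_inter φ χ
  refine ⟨ψ, fun δ hδ hc => ?_⟩
  have hkey : ∀ α ∈ closurePoints ψ, ∀ x, e' (f x) < α ↔ e x < α := fun α hα =>
    key α (hχ (hψ hα).2).1 (hχ (hψ hα).2).2
  obtain ⟨v, ⟨x, m, hx, hxc⟩, hcof⟩ := hφ δ (hψ hδ).1 fun p => (hψ (hc p)).1
  refine ⟨f v, ⟨f ∘ x, m, hx.map f, fun n p => ?_⟩, fun α hα => ?_⟩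
  · rw [← hxc n p, ← not_lt, ← not_lt]
    exact not_congr (hkey _ (hc p) _)
  -- All vertices sent to or below `α` lie below `η`, so a neighbour beyond `η` is sent beyond `α`.
  · obtain ⟨η, hη, H⟩ := hg₂ _ (hχ (hψ hδ).2).2 α hα
    obtain ⟨y, hvy, hηy, hyδ⟩ := hcof η hη
    refine ⟨f y, f.toHom.map_adj hvy, ?_, (hkey _ hδ y).2 hyδ⟩
    by_contra hlt
    exact absurd (H ⟨e y, by simpa using (not_le.1 hlt).le⟩) (not_lt.2 hηy)

end Spectrum

end EndClass

namespace EndClass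

/-! ### Tail-equivalence from eventual agreement -/

section Tails

variable {V : Type u} {G : SimpleGraph V} {v : V}

theorem IsRaySeq.copy_adj {x : ℕ → V} (hx : IsRaySeq G v x) (n : ℕ) :
    hx.copy.toSubgraph.Adj (hx.copy n) (hx.copy (n + 1)) := by
  refine ⟨n, n + 1, ?_, rfl, rfl⟩
  change (SimpleGraph.hasse ℕ).Adj n (n + 1)
  rw [SimpleGraph.hasse_adj, Nat.covBy_iff_add_one_eq]
  exact Or.inl rfl

theorem IsRaySeq.toSubgraph_le {x : ℕ → V} (hx : IsRaySeq G v x)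
    {R : (G.induce (G.neighborSet v)).Subgraph} (hv : ∀ n, hx.copy n ∈ R.verts)
    (hR : ∀ n, R.Adj (hx.copy n) (hx.copy (n + 1))) : hx.copy.toSubgraph ≤ R := by
  refine ⟨?_, ?_⟩
  · rintro _ ⟨n, -, rfl⟩
    exact hv n
  · rintro _ _ ⟨a, b, h, rfl, rfl⟩
    have h' : (SimpleGraph.hasse ℕ).Adj a b := h
    rw [SimpleGraph.hasse_adj, Nat.covBy_iff_add_one_eq, Nat.covBy_iff_add_one_eq] at h'
    rcases h' with rfl | rfl
    · exact hR a
    · exact (hR b).symm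

theorem IsRaySeq.isTail_shift {x : ℕ → V} (hx : IsRaySeq G v x) (m : ℕ) :
    IsTail (hx.shift m).copy.toSubgraph hx.copy.toSubgraph := by
  refine ⟨(hx.shift m).toSubgraph_le (fun n => ⟨n + m, trivial, rfl⟩) fun n => ?_, ?_, ?_⟩
  · have := hx.copy_adj (n + m)
    have h2 : (hx.shift m).copy (n + 1) = hx.copy (n + m + 1) :=
      congrArg hx.copy (Nat.add_right_comm n 1 m)
    rw [h2]
    exact this
  · have h := Set.infinite_range_of_injective (hx.shift m).copy.injective
    refine h.mono ?_
    rintro _ ⟨n, rfl⟩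
    exact ⟨n, trivial, rfl⟩
  · rw [SimpleGraph.Subgraph.connected_iff']
    have hc : (SimpleGraph.hasse ℕ).Connected :=
      { preconnected := SimpleGraph.hasse_preconnected_of_succ ℕ
        nonempty := ⟨0⟩ }
    exact (SimpleGraph.Iso.connected_iff (hx.shift m).copy.isoToSubgraph).1 hc

/-- If any two ray enumerations agree after shifts, all rays are tail-equivalent. -/
theorem tailEquivalent_of_shift {R S : (G.induce (G.neighborSet v)).Subgraph} (hR : IsRay R)
    (hS : IsRay S) (h : ∀ x y : ℕ → V, IsRaySeq G v x → IsRaySeq G v y →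
      ∃ a b, ∀ n, x (n + a) = y (n + b)) : TailEquivalent R S := by
  obtain ⟨x, hx, hxR⟩ := hR.exists_seq
  obtain ⟨y, hy, hyS⟩ := hS.exists_seq
  obtain ⟨a, b, hab⟩ := h x y hx hy
  have hT₁ := hx.isTail_shift a
  have hT₂ := hy.isTail_shift b
  have heq : (hy.shift b).copy.toSubgraph = (hx.shift a).copy.toSubgraph := by
    congr 2
    funext n
    exact (hab n).symm
  rw [heq] at hT₂
  exact ⟨_, ⟨hT₁.1.trans hxR, hT₁.2⟩, ⟨hT₂.1.trans hyS, hT₂.2⟩⟩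

end Tails

/-- An injective walk on `ℕ` only goes up. -/
theorem eq_add_of_injective_of_step {k : ℕ → ℕ} (hk : Function.Injective k)
    (hstep : ∀ n, k (n + 1) = k n + 1 ∨ k n = k (n + 1) + 1) (n : ℕ) : k n = k 0 + n := by
  have hup : ∀ n, k (n + 1) = k n + 1 := by
    intro n
    refine (hstep n).resolve_right fun hn => ?_
    have hdown : ∀ j, k (n + j) = k (n + j + 1) + 1 := by
      intro j
      induction j with
      | zero => exact hn
      | succ j ih =>
        refine (hstep (n + j + 1)).resolve_left fun h => ?_
        have := hk (h.trans ih.symm)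
        omega
    have hsum : ∀ j, k n = k (n + j) + j := by
      intro j
      induction j with
      | zero => rfl
      | succ j ih =>
        have := hdown j
        rw [Nat.add_assoc] at this
        omega
    -- This many downward steps would pass zero.
    have := hsum (k n + 1)
    omega
  induction n with
  | zero => rfl
  | succ n ih => rw [hup, ih, Nat.add_assoc]

/-! ### The tree with apices belongs to the class -/

section TreeGraph

variable {I Γ : Type u}

/-- The finite initial segments of the sequence `b`, written backwards. -/
def branchNode (b : ℕ → I) : ℕ → List I
  | 0 => []
  | n + 1 => b n :: branchNode b n

@[simp] theorem length_branchNode (b : ℕ → I) (n : ℕ) : (branchNode b n).length = n := by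
  induction n with
  | zero => rfl
  | succ n ih => simp [branchNode, ih]

theorem branchNode_injective (b : ℕ → I) : Function.Injective (branchNode b) := fun m n h => by
  simpa using congrArg List.length h

theorem mem_branchNode {b : ℕ → I} {n : ℕ} {a : I} (h : a ∈ branchNode b n) :
    ∃ m < n, a = b m := by
  induction n with
  | zero => simp [branchNode] at h
  | succ n ih =>
    rcases List.mem_cons.1 h with rfl | h
    · exact ⟨n, n.lt_succ_self, rfl⟩
    · obtain ⟨m, hm, rfl⟩ := ih h
      exact ⟨m, hm.trans n.lt_succ_self, rfl⟩

/-- Vertices: the nodes of the tree of finite sequences, the marks, and the apices. -/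
abbrev TreeVertex (I Γ : Type u) : Type u := List I ⊕ I ⊕ Γ

/-- The generating relation: a node precedes its one-point extensions, and an apex precedes the
nodes of its branch and its marks. -/
def treeRel (b : Γ → ℕ → I) (s : Γ → Set I) : TreeVertex I Γ → TreeVertex I Γ → Prop
  | .inl l, .inl l' => ∃ a, l' = a :: l
  -- The shift to `n + 1` omits the root, which has no largest entry.
  | .inr (.inr g), .inl l => ∃ n, l = branchNode (b g) (n + 1)
  | .inr (.inr g), .inr (.inl α) => α ∈ s g
  | _, _ => False

/-- The tree of finite sequences, with an apex over each of the chosen branches. -/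
def treeGraph (b : Γ → ℕ → I) (s : Γ → Set I) : SimpleGraph (TreeVertex I Γ) :=
  SimpleGraph.fromRel (treeRel b s)

variable {b : Γ → ℕ → I} {s : Γ → Set I}

theorem treeGraph_adj_node_node {l l' : List I} :
    (treeGraph b s).Adj (.inl l) (.inl l') ↔ (∃ a, l' = a :: l) ∨ ∃ a, l = a :: l' := by
  simp only [treeGraph, SimpleGraph.fromRel_adj, treeRel, and_iff_right_iff_imp]
  rintro (⟨a, rfl⟩ | ⟨a, rfl⟩) <;> simp

theorem treeGraph_adj_apex_node {g : Γ} {l : List I} :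
    (treeGraph b s).Adj (.inr (.inr g)) (.inl l) ↔ ∃ n, l = branchNode (b g) (n + 1) := by
  simp [treeGraph, SimpleGraph.fromRel_adj, treeRel]

theorem treeGraph_adj_apex_mark {g : Γ} {α : I} :
    (treeGraph b s).Adj (.inr (.inr g)) (.inr (.inl α)) ↔ α ∈ s g := by
  simp [treeGraph, SimpleGraph.fromRel_adj, treeRel]

theorem treeGraph_not_adj_apex_apex {g g' : Γ} :
    ¬ (treeGraph b s).Adj (.inr (.inr g)) (.inr (.inr g')) := by
  simp [treeGraph, SimpleGraph.fromRel_adj, treeRel]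

theorem treeGraph_not_adj_mark_node {α : I} {l : List I} :
    ¬ (treeGraph b s).Adj (.inr (.inl α)) (.inl l) := by
  simp [treeGraph, SimpleGraph.fromRel_adj, treeRel]

theorem treeGraph_not_adj_mark_mark {α β : I} :
    ¬ (treeGraph b s).Adj (.inr (.inl α)) (.inr (.inl β)) := by
  simp [treeGraph, SimpleGraph.fromRel_adj, treeRel]

/-- The neighbours of a mark are apices, hence independent. -/
theorem not_isRaySeq_mark {α : I} {x : ℕ → TreeVertex I Γ} :
    ¬ IsRaySeq (treeGraph b s) (.inr (.inl α)) x := by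
  intro hx
  have h : ∀ n, ∃ g, x n = .inr (.inr g) := fun n => by
    have := hx.adj n
    rcases hxn : x n with l | β | g
    · exact absurd (hxn ▸ this) treeGraph_not_adj_mark_node
    · exact absurd (hxn ▸ this) treeGraph_not_adj_mark_mark
    · exact ⟨g, rfl⟩
  obtain ⟨g, hg⟩ := h 0
  obtain ⟨g', hg'⟩ := h 1
  have := hx.adj_succ 0
  rw [hg, hg'] at this
  exact treeGraph_not_adj_apex_apex this

/-- Around a node, each passage of a ray through an apex uses the parent of the node. -/
theorem IsRaySeq.exists_parent {l : List I} {x : ℕ → TreeVertex I Γ}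
    (hx : IsRaySeq (treeGraph b s) (.inl l) x) {n : ℕ} {g : Γ} (hn : x (n + 1) = .inr (.inr g)) :
    ∃ t, t = l.tail ∧ (x n = .inl t ∨ x (n + 2) = .inl t) := by
  have hnode : ∀ {v}, (treeGraph b s).Adj (.inl l) v → (treeGraph b s).Adj (.inr (.inr g)) v →
      ∃ t, v = .inl t ∧ (∃ k, t = branchNode (b g) (k + 1)) ∧
        (t = l.tail ∨ t.length = l.length + 1) := by
    intro v h₁ h₂
    rcases v with t | β | g'
    · refine ⟨t, rfl, treeGraph_adj_apex_node.1 h₂, ?_⟩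
      rcases treeGraph_adj_node_node.1 h₁ with ⟨a, rfl⟩ | ⟨a, rfl⟩
      · exact Or.inr rfl
      · exact Or.inl rfl
    · exact absurd h₁.symm treeGraph_not_adj_mark_node
    · exact absurd h₂ treeGraph_not_adj_apex_apex
  obtain ⟨t, ht, ⟨k, hk⟩, ht'⟩ := hnode (hx.adj n) (hn ▸ (hx.adj_succ n).symm)
  obtain ⟨t₂, ht₂, ⟨k₂, hk₂⟩, ht₂'⟩ := hnode (hx.adj (n + 2)) (hn ▸ hx.adj_succ (n + 1))
  refine ⟨_, rfl, ?_⟩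
  rcases ht' with rfl | ht'
  · exact Or.inl ht
  rcases ht₂' with rfl | ht₂'
  · exact Or.inr ht₂
  rw [hk, length_branchNode] at ht'
  rw [hk₂, length_branchNode] at ht₂'
  -- Otherwise both neighbours are the only child of `l` on this branch.
  have hkk : k = k₂ := by omega
  have := hx.injective (a₁ := n) (a₂ := n + 2) (by rw [ht, ht₂, hk, hk₂, hkk])
  omega

/-- The nodes adjacent to `l` have lengths of equal parity, so no two are adjacent and every second
vertex of a ray is an apex. Each apex after the start has the parent of `l` beside it, so the parent
recurs: once among indices `0` to `3`, again from `4` on. -/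
theorem not_isRaySeq_node {l : List I} {x : ℕ → TreeVertex I Γ} :
    ¬ IsRaySeq (treeGraph b s) (.inl l) x := by
  intro hx
  have hapex : ∀ n, (∃ g, x n = .inr (.inr g)) ∨ ∃ g, x (n + 1) = .inr (.inr g) := by
    have hmark : ∀ n, (∃ t, x n = .inl t ∧ ((∃ a, t = a :: l) ∨ ∃ a, l = a :: t)) ∨
        ∃ g, x n = .inr (.inr g) := fun n => by
      have := hx.adj n
      rcases hxn : x n with t | β | g
      · exact Or.inl ⟨t, rfl, treeGraph_adj_node_node.1 (hxn ▸ this)⟩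
      · exact absurd (hxn ▸ this).symm treeGraph_not_adj_mark_node
      · exact Or.inr ⟨g, rfl⟩
    intro n
    rcases hmark n with ⟨t, ht, htl⟩ | h
    · rcases hmark (n + 1) with ⟨t', ht', htl'⟩ | h'
      · have := hx.adj_succ n
        rw [ht, ht', treeGraph_adj_node_node] at this
        have hlen : t'.length = t.length + 1 ∨ t.length = t'.length + 1 := by
          rcases this with ⟨a, rfl⟩ | ⟨a, rfl⟩ <;> simp
        have h₁ : t.length = l.length + 1 ∨ l.length = t.length + 1 := by
          rcases htl with ⟨a, rfl⟩ | ⟨a, rfl⟩ <;> simp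
        have h₂ : t'.length = l.length + 1 ∨ l.length = t'.length + 1 := by
          rcases htl' with ⟨a, rfl⟩ | ⟨a, rfl⟩ <;> simp
        omega
      · exact Or.inr h'
    · exact Or.inl h
  have hparent : ∀ n, ∃ m, n ≤ m ∧ m ≤ n + 3 ∧ x m = .inl l.tail := by
    intro n
    rcases hapex (n + 1) with ⟨g, hg⟩ | ⟨g, hg⟩
    · obtain ⟨_, rfl, h | h⟩ := hx.exists_parent hg
      · exact ⟨n, by omega, by omega, h⟩
      · exact ⟨n + 2, by omega, by omega, h⟩
    · obtain ⟨_, rfl, h | h⟩ := hx.exists_parent hg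
      · exact ⟨n + 1, by omega, by omega, h⟩
      · exact ⟨n + 3, by omega, by omega, h⟩
  obtain ⟨m, -, hm, hxm⟩ := hparent 0
  obtain ⟨m', hm', -, hxm'⟩ := hparent 4
  have := hx.injective (hxm.trans hxm'.symm)
  omega

/-- A ray in the neighbourhood of an apex runs along its branch. -/
theorem IsRaySeq.exists_branchNode {g : Γ} {x : ℕ → TreeVertex I Γ}
    (hx : IsRaySeq (treeGraph b s) (.inr (.inr g)) x) :
    ∃ k : ℕ → ℕ, ∀ n, x n = .inl (branchNode (b g) (k n + 1)) := by
  have : ∀ n, ∃ k, x n = .inl (branchNode (b g) (k + 1)) := fun n => by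
    have h := hx.adj n
    rcases hxn : x n with l | β | g'
    · obtain ⟨k, rfl⟩ := treeGraph_adj_apex_node.1 (hxn ▸ h)
      exact ⟨k, rfl⟩
    · have h₁ := hx.adj_succ n
      have h₂ := hx.adj (n + 1)
      rw [hxn] at h₁
      rcases hxn' : x (n + 1) with l | γ | g'
      · exact absurd (hxn' ▸ h₁) treeGraph_not_adj_mark_node
      · exact absurd (hxn' ▸ h₁) treeGraph_not_adj_mark_mark
      · exact absurd (hxn' ▸ h₂) treeGraph_not_adj_apex_apex
    · exact absurd (hxn ▸ h) treeGraph_not_adj_apex_apex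
  choose k hk using this
  exact ⟨k, hk⟩

theorem IsRaySeq.exists_eq_branchNode_add {g : Γ} {x : ℕ → TreeVertex I Γ}
    (hx : IsRaySeq (treeGraph b s) (.inr (.inr g)) x) :
    ∃ k, ∀ n, x n = .inl (branchNode (b g) (k + n + 1)) := by
  obtain ⟨k, hk⟩ := hx.exists_branchNode
  have hinj : Function.Injective k := fun m n h => hx.injective (by rw [hk, hk, h])
  have hstep : ∀ n, k (n + 1) = k n + 1 ∨ k n = k (n + 1) + 1 := fun n => by
    have := hx.adj_succ n
    rw [hk, hk, treeGraph_adj_node_node] at this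
    rcases this with ⟨a, ha⟩ | ⟨a, ha⟩
    · have := congrArg List.length ha
      simp only [length_branchNode, List.length_cons] at this
      omega
    · have := congrArg List.length ha
      simp only [length_branchNode, List.length_cons] at this
      omega
  exact ⟨k 0, fun n => by rw [hk, eq_add_of_injective_of_step hinj hstep n]⟩

theorem isRaySeq_branchNode (g : Γ) :
    IsRaySeq (treeGraph b s) (.inr (.inr g)) fun n => .inl (branchNode (b g) (n + 1)) where
  injective _ _ h := Nat.succ_injective (branchNode_injective _ (Sum.inl_injective h))
  adj n := treeGraph_adj_apex_node.2 ⟨n, rfl⟩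
  adj_succ _ := treeGraph_adj_node_node.2 (Or.inl ⟨_, rfl⟩)

/-- Only apices have rays around them; there the marks are isolated and the nodes form a single
path. -/
theorem inClass_treeGraph (b : Γ → ℕ → I) (s : Γ → Set I) : InClass (treeGraph b s) := by
  intro v R S hR hS
  refine tailEquivalent_of_shift hR hS fun x y hx hy => ?_
  rcases v with l | α | g
  · exact absurd hx not_isRaySeq_node
  · exact absurd hx not_isRaySeq_mark
  · obtain ⟨k, hk⟩ := hx.exists_eq_branchNode_add
    obtain ⟨m, hm⟩ := hy.exists_eq_branchNode_add
    refine ⟨m, k, fun n => ?_⟩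
    rw [hk, hm, show k + (n + m) = m + (n + k) by omega]

end TreeGraph

/-! ### Largest entries compared with an arbitrary enumeration -/

section Top

variable {I Γ : Type u} [LinearOrder I]

/-- `a` is the largest entry of a node, or the value of a mark. -/
def HasTop : TreeVertex I Γ → I → Prop
  | .inl l, a => a ∈ l ∧ ∀ a' ∈ l, a' ≤ a
  | .inr (.inl α), a => a = α
  | .inr (.inr _), _ => False

theorem HasTop.eq {v : TreeVertex I Γ} {a a' : I} (h : HasTop v a) (h' : HasTop v a') : a = a' := by
  rcases v with l | α | g
  · exact le_antisymm (h'.2 _ h.1) (h.2 _ h'.1)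
  · exact Eq.trans h (Eq.symm h')
  · exact h.elim

theorem hasTop_branchNode {b : ℕ → I} (hb : StrictMono b) (n : ℕ) :
    HasTop (Γ := Γ) (.inl (branchNode b (n + 1))) (b n) := by
  refine ⟨List.mem_cons_self, fun a ha => ?_⟩
  obtain ⟨m, hm, rfl⟩ := mem_branchNode ha
  exact hb.monotone (Nat.le_of_lt_succ hm)

/-- Such a vertex is a finite sequence in, or an element of, an initial segment of size below `κ`.
Apices have no top and so are not counted. -/
theorem mk_hasTop_le_lt {κ : Cardinal.{u}} (hI : IsRegularType I κ) (hκ : ℵ₀ < κ) (β : I) :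
    #{v : TreeVertex I Γ // ∃ a ≤ β, HasTop v a} < κ := by
  let F : List (Set.Iic β) ⊕ Set.Iic β → TreeVertex I Γ :=
    Sum.elim (fun l => .inl (l.map Subtype.val)) fun α => .inr (.inl α.1)
  have hsub : {v : TreeVertex I Γ | ∃ a ≤ β, HasTop v a} ⊆ Set.range F := by
    rintro (l | α | g) ⟨a, ha, h⟩
    · refine ⟨.inl (l.attach.map fun x => ⟨x.1, (h.2 _ x.2).trans ha⟩), ?_⟩
      simp only [F, Sum.elim_inl, List.map_map, Function.comp_def, List.attach_map_subtype_val]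
    · obtain rfl : a = α := h
      exact ⟨.inr ⟨a, ha⟩, rfl⟩
    · exact h.elim
  have hβ := hI.card_Iic_lt hκ.le β
  refine (mk_le_mk_of_subset hsub).trans_lt (mk_range_le.trans_lt ?_)
  rw [mk_sum, lift_id, lift_id]
  exact add_lt_of_lt hκ.le ((mk_list_le_max _).trans_lt (max_lt hκ hβ)) hβ

/-- On a closure set, an enumeration of the vertices respects their top entries. -/
theorem exists_closurePoints_top {κ : Cardinal.{u}} (hI : IsRegularType I κ) (hκ : ℵ₀ < κ)
    (e : TreeVertex I Γ ≃ I) : ∃ φ : I → I, ∀ α ∈ closurePoints φ,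
      (∀ v a, HasTop v a → (e v < α ↔ a < α)) ∧
      ∀ β < α, ∃ η < α, ∀ v a, HasTop v a → (η ≤ a → β < e v) ∧ (η ≤ e v → β < a) := by
  obtain ⟨g₁, hg₁⟩ := exists_closurePoints_relation hI hκ.le
    (S := fun β => {v : TreeVertex I Γ // ∃ a, HasTop v a ∧ e v ≤ β}) (fun β v => v.2.choose)
    fun β => (mk_le_of_injective (f := fun v => (⟨e v.1, v.2.choose_spec.2⟩ : Set.Iic β))
      fun v w h => Subtype.ext (e.injective (congrArg Subtype.val h))).trans_lt
        (hI.card_Iic_lt hκ.le β)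
  obtain ⟨g₂, hg₂⟩ := exists_closurePoints_relation hI hκ.le
    (S := fun β => {v : TreeVertex I Γ // ∃ a ≤ β, HasTop v a}) (fun β v => e v.1)
    fun β => mk_hasTop_le_lt hI hκ β
  obtain ⟨φ, hφ⟩ := exists_closurePoints_inter g₁ g₂
  have key : ∀ α ∈ closurePoints φ, ∀ β < α, ∃ η < α, ∀ v a, HasTop v a →
      (e v ≤ β → a < η) ∧ (a ≤ β → e v < η) := by
    intro α hα β hβ
    obtain ⟨η₁, hη₁, H₁⟩ := hg₁ α (hφ hα).1 β hβ
    obtain ⟨η₂, hη₂, H₂⟩ := hg₂ α (hφ hα).2 β hβ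
    refine ⟨max η₁ η₂, max_lt hη₁ hη₂, fun v a ha => ⟨fun h => ?_, fun h => ?_⟩⟩
    · have hex : ∃ a, HasTop v a ∧ e v ≤ β := ⟨a, ha, h⟩
      have := H₁ ⟨v, hex⟩
      rw [ha.eq hex.choose_spec.1]
      exact this.trans_le (le_max_left _ _)
    · exact (H₂ ⟨v, a, h, ha⟩).trans_le (le_max_right _ _)
  refine ⟨φ, fun α hα => ⟨fun v a ha => ⟨fun h => ?_, fun h => ?_⟩, fun β hβ => ?_⟩⟩
  · obtain ⟨η, hη, H⟩ := key α hα _ h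
    exact ((H v a ha).1 le_rfl).trans hη
  · obtain ⟨η, hη, H⟩ := key α hα _ h
    exact ((H v a ha).2 le_rfl).trans hη
  · obtain ⟨η, hη, H⟩ := key α hα β hβ
    exact ⟨η, hη, fun v a ha => ⟨fun h => not_le.1 fun h' => absurd ((H v a ha).1 h') (not_lt.2 h),
      fun h => not_le.1 fun h' => absurd ((H v a ha).2 h') (not_lt.2 h)⟩⟩

end Top

/-! ### Realising a prescribed set of codes -/

section Realisation

variable {I N P C : Type u} [LinearOrder I] [LinearOrder N] [LinearOrder P]

/-- The graph whose spectrum is `B`. -/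
def codeGraph (c : LadderPoint N I → P → I) (pos : C → ℕ → P) (B : Set C) :
    SimpleGraph (TreeVertex I (LadderPoint N I × B)) :=
  treeGraph (fun g n => c g.1 (pos g.2 n)) fun g => Set.range g.1.ladder

variable {c : LadderPoint N I → P → I} {pos : C → ℕ → P} {B : Set C}

omit [LinearOrder P] in
theorem codeGraph_adj_apex_mark {g : LadderPoint N I × B} {α : I} :
    (codeGraph c pos B).Adj (.inr (.inr g)) (.inr (.inl α)) ↔ α ∈ Set.range g.1.ladder :=
  treeGraph_adj_apex_mark (s := fun g : LadderPoint N I × B => Set.range g.1.ladder)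

/-- The apex of `δ` and `a` is the witness: the tops along its branch are `c δ (pos a n)`, and its
marks are cofinal in `δ`. -/
theorem subset_spectrum_codeGraph {κ : Cardinal.{u}} (hI : IsRegularType I κ) (hκ : ℵ₀ < κ)
    (hc : ∀ δ, StrictMono (c δ)) (hpos : ∀ a, StrictMono (pos a))
    (e : TreeVertex I (LadderPoint N I × B) ≃ I) :
    B ⊆ spectrum (fun δ : LadderPoint N I => δ.1) c pos (codeGraph c pos B) e := by
  intro a ha
  obtain ⟨φ, hφ⟩ := exists_closurePoints_top hI hκ e
  refine ⟨φ, fun δ hδ hcδ => ⟨.inr (.inr (δ, ⟨a, ha⟩)), ⟨_, 0, isRaySeq_branchNode _, ?_⟩, ?_⟩⟩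
  · intro n p
    have h := (hφ _ (hcδ p)).1 _ _ (hasTop_branchNode ((hc δ).comp (hpos a)) n)
    exact not_lt.symm.trans ((not_congr (h.trans (hc δ).lt_iff_lt)).trans not_lt)
  · intro α hα
    obtain ⟨htop, hη⟩ := hφ _ hδ
    obtain ⟨η, hη, H⟩ := hη α hα
    obtain ⟨i, hi⟩ := δ.isLadder.exists_ge η hη
    have ht : HasTop (Γ := LadderPoint N I × B) (.inr (.inl (δ.ladder i))) (δ.ladder i) := rfl
    exact ⟨.inr (.inl (δ.ladder i)), codeGraph_adj_apex_mark.2 ⟨i, rfl⟩, ((H _ _ ht).1 hi).le,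
      (htop _ _ ht).2 (δ.isLadder.lt i)⟩

/-- Ladder points are determined by any set of few points together with a ladder. -/
theorem LadderPoint.eq_of_cofinal {μ : Cardinal.{u}} (hN : IsRegularType N (Order.succ μ))
    (hμ : ℵ₀ ≤ μ) {δ δ' : LadderPoint N I} {b : ℕ → I} (hb : ∀ n, b n < δ'.1)
    (h : ∀ α < δ.1, ∃ a, α < a ∧ a < δ.1 ∧ (a ∈ Set.range b ∨ a ∈ Set.range δ'.ladder)) :
    δ = δ' := by
  rcases lt_trichotomy δ.1 δ'.1 with hlt | heq | hlt
  -- At most `μ` ladder values of `δ'` lie below `δ`; even with the countable set added they cannot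
  -- be cofinal in `δ`.
  · exfalso
    obtain ⟨i₀, hi₀⟩ := δ'.isLadder.exists_ge _ hlt
    let X : ULift.{u} ℕ ⊕ Set.Iio i₀ → I := Sum.elim (fun n => b n.down) fun i => δ'.ladder i
    have hX : ∀ t, ∃ j, X t < δ.1 → X t ≤ δ.ladder j := fun t => by
      by_cases ht : X t < δ.1
      · obtain ⟨j, hj⟩ := δ.isLadder.exists_ge _ ht
        exact ⟨j, fun _ => hj⟩
      · exact ⟨i₀, fun h => absurd h ht⟩
    choose j hj using hX
    have hle : ℵ₀ < Order.succ μ := Order.lt_succ_of_le hμ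
    obtain ⟨k, hk⟩ := hN.exists_gt j (by
      rw [mk_sum, lift_id, lift_id]
      exact add_lt_of_lt hle.le (by simpa using hle) (hN.card_Iio_lt i₀))
    obtain ⟨a, hka, haδ, ha⟩ := h _ (δ.isLadder.lt k)
    have hcon : ∀ t, X t = a → False := fun t ht =>
      absurd (hj t (ht ▸ haδ)) (not_le.2 ((δ.isLadder.strictMono (hk t)).trans (ht ▸ hka)))
    rcases ha with ⟨n, hn⟩ | ⟨i, hi⟩
    · exact hcon (.inl ⟨n⟩) hn
    · refine hcon (.inr ⟨i, ?_⟩) hi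
      exact δ'.isLadder.strictMono.lt_iff_lt.1 ((hi.trans_lt haδ).trans_le hi₀)
  · exact Subtype.ext heq
  · exfalso
    obtain ⟨a, ha, -, ⟨n, rfl⟩ | ⟨i, rfl⟩⟩ := h _ hlt
    · exact absurd (hb n) ha.not_gt
    · exact absurd (δ'.isLadder.lt i) ha.not_gt

/-- A located vertex must be an apex, over `δ'` and some `h ∈ B`. Its neighbours have tops in a
countable branch or in the ladder of `δ'`, so cofinality forces `δ = δ'`. Its ray follows the
branch, so `pos a` and `pos h` meet infinitely often. -/
theorem spectrum_codeGraph_subset {κ μ : Cardinal.{u}} (hI : IsRegularType I κ) (hκ : ℵ₀ < κ)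
    (hN : IsRegularType N (Order.succ μ)) (hμ : ℵ₀ ≤ μ)
    (hc : ∀ δ, StrictMono (c δ)) (hcδ : ∀ δ p, c δ p < δ.1) (hpos : ∀ a, StrictMono (pos a))
    (hpos' : ∀ a b, {n | ∃ m, pos a n = pos b m}.Infinite → a = b)
    (hguess : ∀ φ : I → I, ∃ δ : LadderPoint N I, δ.1 ∈ closurePoints φ ∧
      ∀ p, c δ p ∈ closurePoints φ)
    (e : TreeVertex I (LadderPoint N I × B) ≃ I) :
    spectrum (fun δ : LadderPoint N I => δ.1) c pos (codeGraph c pos B) e ⊆ B := by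
  rintro a ⟨ψ, hψ⟩
  obtain ⟨φ, hφ⟩ := exists_closurePoints_top hI hκ e
  obtain ⟨χ, hχ⟩ := exists_closurePoints_inter φ ψ
  obtain ⟨δ, hδ, hδc⟩ := hguess χ
  obtain ⟨v, ⟨x, m, hx, hxc⟩, hcof⟩ := hψ δ (hχ hδ).2 fun p => (hχ (hδc p)).2
  rcases v with l | α | ⟨δ', h⟩
  · exact absurd hx not_isRaySeq_node
  · exact absurd hx not_isRaySeq_mark
  have hb : StrictMono fun n => c δ' (pos h n) := (hc δ').comp (hpos h)
  obtain rfl : δ = δ' := by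
    refine LadderPoint.eq_of_cofinal hN hμ (b := fun n => c δ' (pos h n)) (fun n => hcδ _ _)
      fun α hα => ?_
    obtain ⟨htop, hη⟩ := hφ _ (hχ hδ).1
    obtain ⟨η, hη, H⟩ := hη α hα
    obtain ⟨y, hy, hηy, hyδ⟩ := hcof η hη
    rcases y with l | γ | g
    · obtain ⟨n, rfl⟩ := treeGraph_adj_apex_node.1 hy
      have ht := hasTop_branchNode (Γ := LadderPoint N I × B) hb n
      exact ⟨_, (H _ _ ht).2 hηy, (htop _ _ ht).1 hyδ, Or.inl ⟨n, rfl⟩⟩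
    · have ht : HasTop (Γ := LadderPoint N I × B) (.inr (.inl γ)) γ := rfl
      refine ⟨_, (H _ _ ht).2 hηy, (htop _ _ ht).1 hyδ, Or.inr ?_⟩
      exact codeGraph_adj_apex_mark.1 hy
    · exact absurd hy treeGraph_not_adj_apex_apex
  obtain ⟨k, hk⟩ := hx.exists_branchNode
  have hpk : ∀ n, pos a (n + m) = pos h (k n) := fun n => eq_of_forall_le_iff fun p => by
    rw [← hxc n p, hk]
    exact not_lt.symm.trans ((not_congr (((hφ _ (hχ (hδc p)).1).1 _ _
      (hasTop_branchNode hb (k n))).trans (hc δ).lt_iff_lt)).trans not_lt)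
  have : a = h := hpos' a h <| (Set.infinite_range_of_injective
    (f := fun n => n + m) fun _ _ h => Nat.add_right_cancel h).mono (by
      rintro _ ⟨n, rfl⟩
      exact ⟨k n, hpk n⟩)
  exact this ▸ h.2

end Realisation

/-! ### Almost disjoint sequences of positions -/

section Positions

variable {M : Type u} [LinearOrder M]

/-- The position of stage `n` of the sequence `h`: it records `n` and `h` below `n`. -/
def position (code : List M → M) (h : ℕ → M) (n : ℕ) : ULift.{u} ℕ ×ₗ M :=
  toLex (⟨n⟩, code ((List.range n).map h))

theorem position_strictMono (code : List M → M) (h : ℕ → M) : StrictMono (position code h) :=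
  fun _ _ hmn => Prod.Lex.toLex_lt_toLex.2 (Or.inl hmn)

-- A shared position fixes the stage `n` and the first `n` values; unboundedly many fix the whole
-- sequence.
omit [LinearOrder M] in
theorem position_eq {code : List M → M} (hcode : Function.Injective code) {h h' : ℕ → M}
    (hinf : {n | ∃ m, position code h n = position code h' m}.Infinite) : h = h' := by
  funext i
  obtain ⟨n, ⟨m, hnm⟩, hin⟩ := hinf.exists_gt i
  have h₁ := Prod.ext_iff.1 (toLex.injective hnm)
  obtain rfl : n = m := congrArg ULift.down h₁.1
  exact List.map_inj_left.1 (hcode h₁.2) i (List.mem_range.2 hin)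

end Positions

end EndClass

/-! ### Assembly of the homomorphism -/

theorem theorem2p4 (κ : Cardinal.{u}) (hκ : κ.IsRegular)
    (μ : Cardinal.{u}) (hμ : ℵ₀ ≤ μ) (hμκ : Order.succ μ < κ)
    (A : Type u) (hA : #A = μ ^ ℵ₀) :
    ∃ Φ : EndClass.IsoType κ →o {B : Set A // #B ≤ κ}, Function.Surjective Φ := by
  open EndClass in
  let I := κ.ord.ToType
  let N := (Order.succ μ).ord.ToType
  let M := μ.ord.ToType
  have hI : IsRegularType I κ := isRegularType_ord_toType hκ
  have hN : IsRegularType N (Order.succ μ) := isRegularType_ord_toType (isRegular_succ hμ)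
  have hM : #M = μ := mk_ord_toType μ
  have hκ₀ : ℵ₀ < κ := hμ.trans_lt ((Order.lt_succ μ).trans hμκ)
  have hP : #(ULift.{u} ℕ ×ₗ M) ≤ μ := by
    rw [show #(ULift.{u} ℕ ×ₗ M) = #(ULift.{u} ℕ × M) from rfl]
    simp [hM, aleph0_mul_eq hμ]
  obtain ⟨c, hc, hcδ, hguess⟩ := exists_guess (P := ULift.{u} ℕ ×ₗ M) hI hN hμ hμκ hP
  obtain ⟨E⟩ : Nonempty (A ≃ (ℕ → M)) := by
    rw [← Cardinal.eq, hA]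
    simp [hM]
  obtain ⟨code⟩ : Nonempty (List M ≃ M) := by
    have : Infinite M := infinite_iff.2 (hM ▸ hμ)
    exact Cardinal.eq.1 (mk_list_eq_mk M)
  let pos : A → ℕ → ULift.{u} ℕ ×ₗ M := fun a => position code (E a)
  have hpos : ∀ a, StrictMono (pos a) := fun a => position_strictMono code (E a)
  have hpos' : ∀ a b, {n | ∃ m, pos a n = pos b m}.Infinite → a = b := fun a b h =>
    E.injective (position_eq code.injective h)
  have hΔ : #(LadderPoint N I) ≤ κ := (mk_subtype_le _).trans hI.card_eq.le
  have hequiv : ∀ {V : Type u}, #V = κ → Nonempty (V ≃ I) := fun h =>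
    Cardinal.eq.1 (h.trans hI.card_eq.symm)
  let d : LadderPoint N I → I := fun δ => δ.1
  let Ψ : ClassGraph κ → {B : Set A // #B ≤ κ} := fun G =>
    ⟨spectrum d c pos G.graph (hequiv G.card_eq).some,
      mk_spectrum_le hκ₀.le hΔ G.card_eq.le G.inClass _ hpos' hguess⟩
  have hΨ : ∀ G H : ClassGraph κ, G.graph.IsContained H.graph → Ψ G ≤ Ψ H := fun G H ⟨f⟩ =>
    spectrum_mono hI hκ₀.le f
  -- Isomorphic graphs embed in each other, so monotonicity already gives invariance, whatever
  -- enumerations were chosen.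
  refine ⟨⟨Quotient.lift Ψ fun G H ⟨f⟩ => le_antisymm (hΨ G H ⟨f.toCopy⟩) (hΨ H G ⟨f.symm.toCopy⟩),
    ?_⟩, ?_⟩
  · rintro ⟨G⟩ ⟨H⟩ h
    exact hΨ G H h
  · rintro ⟨B, hB⟩
    have hcard : #(TreeVertex I (LadderPoint N I × B)) = κ := by
      have : Infinite I := infinite_iff.2 (hI.card_eq ▸ hκ₀.le)
      have hΓ : #(LadderPoint N I × B) ≤ κ := by
        rw [mk_prod, lift_id, lift_id]
        exact (mul_le_mul' hΔ hB).trans (mul_eq_self hκ₀.le).le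
      rw [mk_sum, mk_sum, lift_id, lift_id, lift_id, lift_id, mk_list_eq_mk, hI.card_eq,
        add_eq_left hκ₀.le hΓ, add_eq_self hκ₀.le]
    let G : ClassGraph κ := ⟨_, codeGraph c pos B, inClass_treeGraph _ _, hcard⟩
    refine ⟨Quotient.mk _ G, Subtype.ext (Set.Subset.antisymm ?_ ?_)⟩
    · exact spectrum_codeGraph_subset hI hκ₀ hN hμ hc hcδ hpos hpos' hguess _
    · exact subset_spectrum_codeGraph hI hκ₀ hc hpos _
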